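/- Let $d,n\ge 0$ be integers and let $\beta^{(2n)}=\{\beta_{\mathbf i}\}_{\mathbf i\in\mathbb Z_+^d,\ |\mathbf i|\le 2n}$ be a real truncated multisequence, where $|\mathbf i|=i_1+\dots+i_d$, with moment matrix $M(n)=(\beta_{\mathbf i+\mathbf j})_{|\mathbf i|,|\mathbf j|\le n}$. Suppose that $M(n)$ is positive semidefinite and admits a flat extension $M(n+1)$; that is, $M(n+1)=(\gamma_{\mathbf i+\mathbf j})_{|\mathbf i|,|\mathbf j|\le n+1}$ is the moment matrix of a real multisequence $\{\gamma_{\mathbf i}\}_{|\mathbf i|\le 2n+2}$ with $\gamma_{\mathbf i}=\beta_{\mathbf i}$ for $|\mathbf i|\le 2n$, and $\operatorname{rank} M(n+1)=\operatorname{rank} M(n)$. Then $M(n+1)$ has a unique representing measure, i.e. there is exactly one positive Borel measure $\mu$ on $\mathbb R^d$ such that, for all $|\mathbf i|\le 2n+2$, the monomial $\mathbf x^{\mathbf i}$ is $\mu$-integrable and $$\gamma_{\mathbf i}=\int \mathbf x^{\mathbf i}\,d\mu .$$ Moreover $\operatorname{card}\operatorname{supp}\mu=\operatorname{rank} M(n)$,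 and $\mu$ is $\operatorname{rank} M(n)$-atomic, i.e. a sum of exactly $\operatorname{rank} M(n)$ positive point masses at distinct points of $\mathbb R^d$ (the zero measure if $\operatorname{rank} M(n)=0$). -/

import Mathlib

open MeasureTheory

/-- Multi-indices `i = (i₁, …, i_d)` of nonnegative integers with `|i| = i₁ + ⋯ + i_d ≤ m`. -/
abbrev MultiIndex (d m : ℕ) : Type := {i : Fin d →₀ ℕ // i.degree ≤ m}

theorem MultiIndex.finite (d m : ℕ) : Finite (MultiIndex d m) := by
  refine Finite.of_injective
    (fun (i : MultiIndex d m) (k : Fin d) =>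
      (⟨i.1 k, Nat.lt_succ_of_le ((Finsupp.le_degree k i.1).trans i.2)⟩ : Fin (m + 1))) ?_
  intro i j h
  ext k
  exact congrArg Fin.val (congrFun h k)

noncomputable instance MultiIndex.instFintype (d m : ℕ) : Fintype (MultiIndex d m) :=
  @Fintype.ofFinite _ (MultiIndex.finite d m)

/-- A real truncated multisequence `(β_i)`, `|i| ≤ m`, in `d` variables. -/
abbrev TruncSeq (d m : ℕ) : Type := MultiIndex d m → ℝ

/-- The sum of two multi-indices of length at most `n`, of length at most `2 n`. -/
noncomputable def MultiIndex.add {d n : ℕ} (i j : MultiIndex d n) : MultiIndex d (2 * n) :=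
  ⟨i.1 + j.1, by
    have hi := i.2
    have hj := j.2
    rw [map_add]
    omega⟩

/-- The moment matrix `M(n) = (β_{i+j})`, `|i|, |j| ≤ n`, of `β^{(2n)}`. -/
noncomputable def momentMatrix {d n : ℕ} (β : TruncSeq d (2 * n)) :
    Matrix (MultiIndex d n) (MultiIndex d n) ℝ :=
  Matrix.of fun i j => β (i.add j)

/-- The moment matrix of `γ = γ^{(2n+2)}` is a flat extension `M(n+1)` of the moment matrix `M(n)`
of `β = β^{(2n)}`: `γ` extends `β`, and `rank M(n+1) = rank M(n)`. -/
def IsFlatExtension {d n : ℕ} (β : TruncSeq d (2 * n)) (γ : TruncSeq d (2 * (n + 1))) : Prop :=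
  (∀ i : MultiIndex d (2 * n), γ ⟨i.1, i.2.trans (by omega)⟩ = β i) ∧
    (momentMatrix γ).rank = (momentMatrix β).rank

/-- The positive Borel measure `μ` on `ℝ^d` represents `(β_i)`, `|i| ≤ m`: every monomial `x^i` with
`|i| ≤ m` is `μ`-integrable with integral `β_i`. -/
def IsRepresentingMeasure {d m : ℕ} (β : TruncSeq d m) (μ : Measure (Fin d → ℝ)) : Prop :=
  ∀ i : MultiIndex d m,
    Integrable (fun x : Fin d → ℝ => ∏ k, x k ^ i.1 k) μ ∧
      ∫ x : Fin d → ℝ, ∏ k, x k ^ i.1 k ∂μ = β i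

/-- `μ` is `r`-atomic: a sum of exactly `r` positive finite point masses at distinct points. -/
def IsAtomicMeasure {d : ℕ} (r : ℕ) (μ : Measure (Fin d → ℝ)) : Prop :=
  ∃ (S : Finset (Fin d → ℝ)) (c : (Fin d → ℝ) → ℝ),
    S.card = r ∧ (∀ p ∈ S, 0 < c p) ∧
      μ = ∑ p ∈ S, ENNReal.ofReal (c p) • Measure.dirac p

/-! Flatness makes M(n+1) positive semidefinite, hence a Gram matrix. Its Gram vectors span a space
of dimension rank M(n), already filled by the classes of polynomials of degree at most n.
Multiplication by the coordinates is therefore defined on the whole space, as commuting symmetric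
operators (`exists_commuting_symmetric_multiplication`). Split the class of 1 into joint
eigenvectors: the joint eigenvalues are the nodes, the squared norms the weights, and the components
form an orthogonal basis, so there are rank M(n) nodes (`MvPolynomial.exists_quadrature`).

Uniqueness (`eq_sum_dirac_of_quadrature`): any representing measure integrates squares of
polynomials of degree at most n+1 as the quadrature does. Those vanishing at the nodes thus vanish
almost everywhere, which confines the measure to the nodes; interpolating polynomials then read off
the masses. -/

/-! ### Rank-preserving extensions and Gram matrices. -/

open Matrix in
theorem Matrix.exists_mulVec_submatrix_eq_of_rank_submatrix_eq {ι κ : Type*} [Fintype ι]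
    [Fintype κ] (M : Matrix ι ι ℝ) (f : κ → ι) (hrank : M.rank = (M.submatrix f f).rank)
    (v : ι → ℝ) : ∃ w : κ → ℝ, M.submatrix id f *ᵥ w = M *ᵥ v := by
  classical
  have hle : LinearMap.range (M.submatrix id f).mulVecLin ≤ LinearMap.range M.mulVecLin := by
    rw [Matrix.range_mulVecLin, Matrix.range_mulVecLin]
    refine Submodule.span_mono ?_
    rintro _ ⟨j, rfl⟩
    exact ⟨f j, rfl⟩
  -- The rank can only drop from `M` to its column strip and from there to the block, so equal
  -- extremes make the strip span the column space.
  have h1 : (M.submatrix f f).rank ≤ (M.submatrix id f).rank :=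
    Matrix.rank_submatrix_le (M.submatrix id f) f id
  have heq := Submodule.eq_of_le_of_finrank_le hle (by
    change M.rank ≤ (M.submatrix id f).rank
    omega)
  have : M.mulVecLin v ∈ LinearMap.range (M.submatrix id f).mulVecLin := heq ▸ ⟨v, rfl⟩
  obtain ⟨w, hw⟩ := this
  exact ⟨w, hw⟩

-- Any `M *ᵥ v` is a combination, with coefficients `w`, of the selected columns; by symmetry the
-- form of `M` at `v` equals that of the block at `w`.
open Matrix in
theorem Matrix.posSemidef_of_submatrix_of_rank_eq {ι κ : Type*} [Fintype ι] [Fintype κ]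
    (M : Matrix ι ι ℝ) (hM : M.IsHermitian) (f : κ → ι) (hpos : (M.submatrix f f).PosSemidef)
    (hrank : M.rank = (M.submatrix f f).rank) : M.PosSemidef := by
  refine Matrix.PosSemidef.of_dotProduct_mulVec_nonneg hM fun v => ?_
  obtain ⟨w, hw⟩ := M.exists_mulVec_submatrix_eq_of_rank_submatrix_eq f hrank v
  have ht : Mᵀ = M := hM
  have key : v ⬝ᵥ (M *ᵥ v) = w ⬝ᵥ ((M.submatrix f f) *ᵥ w) := by
    have h2 : (M.submatrix f f) *ᵥ w = (M.submatrix f id) *ᵥ v := by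
      funext k
      exact congrFun hw (f k)
    rw [h2, ← hw, Matrix.dotProduct_mulVec, Matrix.dotProduct_mulVec, dotProduct_comm,
      ← Matrix.mulVec_transpose, ← Matrix.mulVec_transpose, Matrix.dotProduct_mulVec,
      Matrix.transpose_submatrix, Matrix.transpose_submatrix, ht, ← Matrix.mulVec_transpose,
      Matrix.transpose_submatrix, ht]
  simpa [key] using hpos.dotProduct_mulVec_nonneg w

open Matrix in
theorem Matrix.PosSemidef.exists_gram {ι : Type*} [Fintype ι] {M : Matrix ι ι ℝ}
    (hM : M.PosSemidef) : ∃ b : ι → EuclideanSpace ℝ ι, Matrix.gram ℝ b = M := by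
  classical
  open scoped MatrixOrder in
  obtain ⟨B, hB⟩ := CStarAlgebra.nonneg_iff_eq_star_mul_self.mp (Matrix.nonneg_iff_posSemidef.mpr hM)
  refine ⟨fun i => WithLp.toLp 2 (B.col i), ?_⟩
  ext i j
  rw [hB, Matrix.gram_apply, Matrix.star_eq_conjTranspose, Matrix.mul_apply,
    PiLp.inner_apply]
  simp [mul_comm]

theorem Matrix.rank_gram_euclidean {ι κ : Type*} [Fintype ι] [Fintype κ]
    (b : κ → EuclideanSpace ℝ ι) :
    (Matrix.gram ℝ b).rank = Module.finrank ℝ (Submodule.span ℝ (Set.range b)) := by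
  classical
  let B : Matrix ι κ ℝ := Matrix.of fun i j => b j i
  have h1 : Matrix.gram ℝ b = B.conjTranspose * B := by
    ext i j
    simp [Matrix.gram_apply, Matrix.mul_apply, PiLp.inner_apply, B, mul_comm]
  rw [h1, Matrix.rank_conjTranspose_mul_self, Matrix.rank_eq_finrank_span_cols]
  have h2 : Set.range B.col = (WithLp.linearEquiv 2 ℝ (ι → ℝ)) '' Set.range b := by
    rw [← Set.range_comp]
    rfl
  rw [h2, ← LinearEquiv.coe_coe, ← Submodule.map_span]
  exact LinearEquiv.finrank_map_eq _ _

/-! ### Multiplication operators, joint eigenvectors and quadrature. -/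

theorem MvPolynomial.linearMap_eq_of_monomial {σ V : Type*} [AddCommMonoid V] [Module ℝ V] {m : ℕ}
    {f g : MvPolynomial σ ℝ →ₗ[ℝ] V}
    (h : ∀ i : σ →₀ ℕ, i.degree ≤ m → f (monomial i 1) = g (monomial i 1))
    {p : MvPolynomial σ ℝ} (hp : p.totalDegree ≤ m) : f p = g p := by
  rw [p.as_sum, map_sum, map_sum]
  refine Finset.sum_congr rfl fun i hi => ?_
  have hi' : i.degree ≤ m := (le_totalDegree hi).trans hp
  rw [← mul_one (coeff i p), ← smul_eq_mul, ← smul_monomial, map_smul, map_smul, h i hi']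

open Module.End in
/-- Joint diagonalisation: a vector is a sum of joint eigenvectors with pairwise orthogonal
terms. -/
theorem LinearMap.IsSymmetric.exists_sum_joint_eigenvectors {ι E : Type*}
    [NormedAddCommGroup E] [InnerProductSpace ℝ E] [FiniteDimensional ℝ E] [Finite ι]
    (T : ι → E →ₗ[ℝ] E) (hT : ∀ k, (T k).IsSymmetric) (hc : ∀ j k, Commute (T j) (T k)) (x : E) :
    ∃ v : (ι → ℝ) →₀ E, (∀ χ k, T k (v χ) = χ k • v χ) ∧
      (∀ χ χ', χ ≠ χ' → inner ℝ (v χ) (v χ') = 0) ∧ v.sum (fun _ y => y) = x := by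
  have htop := LinearMap.IsSymmetric.iSup_iInf_eq_top_of_commute hT (fun j k _ => hc j k)
  have hx : x ∈ ⨆ χ : ι → ℝ, ⨅ k, eigenspace (T k) (χ k) := htop ▸ Submodule.mem_top
  obtain ⟨v, hv, hsum⟩ := (Submodule.mem_iSup_iff_exists_finsupp _ _).mp hx
  refine ⟨v, fun χ k => mem_eigenspace_iff.mp ((Submodule.mem_iInf _).mp (hv χ) k), ?_, hsum⟩
  intro χ χ' hne
  exact LinearMap.IsSymmetric.orthogonalFamily_iInf_eigenspaces hT hne ⟨_, hv χ⟩ ⟨_, hv χ'⟩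

namespace MvPolynomial

/-- The Gelfand-Naimark-Segal data of a linear functional: if `e` realises the form
`(p, q) ↦ L (p * q)` on polynomials of degree at most `n + 1`, and polynomials of degree at most `n`
already fill the space, then multiplication by each variable is a symmetric operator, and these
operators commute. -/
theorem exists_commuting_symmetric_multiplication {σ E : Type*} [NormedAddCommGroup E]
    [InnerProductSpace ℝ E] {n : ℕ} (e : MvPolynomial σ ℝ →ₗ[ℝ] E) (L : MvPolynomial σ ℝ →ₗ[ℝ] ℝ)
    (hinner : ∀ p q : MvPolynomial σ ℝ, p.totalDegree ≤ n + 1 → q.totalDegree ≤ n + 1 →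
      inner ℝ (e p) (e q) = L (p * q))
    (hsurj : ∀ x : E, ∃ p : MvPolynomial σ ℝ, p.totalDegree ≤ n ∧ e p = x) :
    ∃ T : σ → E →ₗ[ℝ] E, (∀ k, (T k).IsSymmetric) ∧ (∀ j k, Commute (T j) (T k)) ∧
      ∀ k (p : MvPolynomial σ ℝ), p.totalDegree ≤ n → T k (e p) = e (X k * p) := by
  have hX : ∀ (k : σ) (p : MvPolynomial σ ℝ), p.totalDegree ≤ n →
      (X k * p).totalDegree ≤ n + 1 := fun k p hp => by
    refine (totalDegree_mul _ _).trans ?_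
    rw [totalDegree_X]
    omega
  let P := restrictTotalDegree σ ℝ n
  obtain ⟨s, hs⟩ := (e ∘ₗ P.subtype).exists_rightInverse_of_surjective (by
    rw [LinearMap.range_eq_top]
    intro x
    obtain ⟨p, hp, rfl⟩ := hsurj x
    exact ⟨⟨p, (mem_restrictTotalDegree σ n p).mpr hp⟩, rfl⟩)
  have hes : ∀ x, e (s x : MvPolynomial σ ℝ) = x := fun x => LinearMap.congr_fun hs x
  have hsd : ∀ x, (s x : MvPolynomial σ ℝ).totalDegree ≤ n :=
    fun x => (mem_restrictTotalDegree σ n _).mp (s x).2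
  let T : σ → E →ₗ[ℝ] E := fun k => e ∘ₗ LinearMap.mulLeft ℝ (X k) ∘ₗ P.subtype ∘ₗ s
  have hTapp : ∀ k x, T k x = e (X k * (s x : MvPolynomial σ ℝ)) := fun k x => rfl
  -- The section `s` is arbitrary. Moving `X k` across the inner product onto `q` shows that `e (X k
  -- * r)` depends only on `e r`, so the choice is harmless.
  have hT : ∀ k (p : MvPolynomial σ ℝ), p.totalDegree ≤ n → T k (e p) = e (X k * p) := by
    intro k p hp
    refine ext_inner_right ℝ fun y => ?_
    obtain ⟨q, hq, rfl⟩ := hsurj y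
    have hshift : ∀ r : MvPolynomial σ ℝ, r.totalDegree ≤ n →
        inner ℝ (e (X k * r)) (e q) = inner ℝ (e r) (e (X k * q)) := fun r hr => by
      rw [hinner _ _ (hX k _ hr) (hq.trans n.le_succ), hinner _ _ (hr.trans n.le_succ) (hX k _ hq),
        mul_comm (X k) r, mul_assoc]
    rw [hTapp, hshift _ (hsd _), hshift _ hp, hes]
  have hsym : ∀ k, (T k).IsSymmetric := by
    intro k x y
    obtain ⟨p, hp, rfl⟩ := hsurj x
    obtain ⟨q, hq, rfl⟩ := hsurj y
    rw [hT k p hp, hT k q hq, hinner _ _ (hX k _ hp) (by omega),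
      hinner _ _ (by omega) (hX k _ hq)]
    congr 1
    ring
  refine ⟨T, hsym, fun j k => ?_, hT⟩
  refine LinearMap.ext fun x => ext_inner_right ℝ fun y => ?_
  obtain ⟨p, hp, rfl⟩ := hsurj x
  obtain ⟨q, hq, rfl⟩ := hsurj y
  rw [Module.End.mul_apply, Module.End.mul_apply, hsym j (T k (e p)), hsym k (T j (e p)),
    hT _ p hp, hT _ p hp, hT _ q hq, hT _ q hq,
    hinner _ _ (hX _ _ hp) (hX _ _ hq), hinner _ _ (hX _ _ hp) (hX _ _ hq)]
  congr 1
  ring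

/-- Induction on the degree: peeling off one variable applies `T k`, which scales `v χ` by `χ k`,
the value of that variable at `χ`. Only the remaining factor needs degree at most `n`, so the
formula reaches `n + 1`. -/
theorem map_eq_sum_eval_smul {σ E : Type*} [AddCommGroup E] [Module ℝ E] {n : ℕ}
    (e : MvPolynomial σ ℝ →ₗ[ℝ] E) (T : σ → E →ₗ[ℝ] E)
    (hT : ∀ k (p : MvPolynomial σ ℝ), p.totalDegree ≤ n → T k (e p) = e (X k * p))
    (v : (σ → ℝ) →₀ E) (hv : ∀ χ k, T k (v χ) = χ k • v χ) (hone : e 1 = v.sum (fun _ y => y))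
    (p : MvPolynomial σ ℝ) (hp : p.totalDegree ≤ n + 1) :
    e p = ∑ χ ∈ v.support, eval χ p • v χ := by
  let f : MvPolynomial σ ℝ →ₗ[ℝ] E :=
    ∑ χ ∈ v.support, (aeval χ : MvPolynomial σ ℝ →ₐ[ℝ] ℝ).toLinearMap.smulRight (v χ)
  have hf : ∀ q, f q = ∑ χ ∈ v.support, eval χ q • v χ := by
    intro q
    simp [f, LinearMap.sum_apply, aeval_eq_eval]
  rw [← hf]
  refine linearMap_eq_of_monomial (m := n + 1) ?_ hp
  have key : ∀ m, m ≤ n + 1 → ∀ i : σ →₀ ℕ, i.degree = m →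
      e (monomial i 1) = f (monomial i 1) := by
    intro m
    induction m with
    | zero =>
      intro _ i hi
      rw [Finsupp.degree_eq_zero_iff] at hi
      subst hi
      rw [hf, ← C_apply, C_1, hone]
      simp [Finsupp.sum]
    | succ m ih =>
      intro hm i hi
      have hi0 : i ≠ 0 := by
        rintro rfl
        simp at hi
      obtain ⟨k, hk⟩ := Finsupp.ne_iff.mp hi0
      have hle : Finsupp.single k 1 ≤ i := by
        rw [Finsupp.single_le_iff]
        exact Nat.one_le_iff_ne_zero.mpr hk
      obtain ⟨j, rfl⟩ := exists_add_of_le hle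
      have hj : j.degree = m := by
        rw [map_add, Finsupp.degree_single] at hi
        omega
      have hmul : (monomial (Finsupp.single k 1 + j) 1 : MvPolynomial σ ℝ)
          = X k * monomial j 1 := by
        rw [X, monomial_mul, one_mul]
      rw [hmul, ← hT k _ ((totalDegree_monomial_le _ _).trans (by
        change j.degree ≤ n
        omega)), ih (by omega) j hj, hf, hf, map_sum]
      refine Finset.sum_congr rfl fun χ _ => ?_
      rw [map_smul, hv, smul_smul, map_mul, eval_X, mul_comm]
  exact fun i hi => key _ hi i rfl

/-- A finite quadrature rule, exact up to degree `2 n + 2`, from the data of a flat functional,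
together with polynomials of degree at most `n` that interpolate at its nodes. -/
theorem exists_quadrature {σ E : Type*} [Finite σ] [NormedAddCommGroup E]
    [InnerProductSpace ℝ E] [FiniteDimensional ℝ E] {n : ℕ}
    (e : MvPolynomial σ ℝ →ₗ[ℝ] E) (L : MvPolynomial σ ℝ →ₗ[ℝ] ℝ)
    (hinner : ∀ p q : MvPolynomial σ ℝ, p.totalDegree ≤ n + 1 → q.totalDegree ≤ n + 1 →
      inner ℝ (e p) (e q) = L (p * q))
    (hsurj : ∀ x : E, ∃ p : MvPolynomial σ ℝ, p.totalDegree ≤ n ∧ e p = x) :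
    ∃ (S : Finset (σ → ℝ)) (c : (σ → ℝ) → ℝ) (l : (σ → ℝ) → MvPolynomial σ ℝ),
      S.card = Module.finrank ℝ E ∧ (∀ χ ∈ S, 0 < c χ) ∧
      (∀ q : MvPolynomial σ ℝ, q.totalDegree ≤ 2 * (n + 1) → L q = ∑ χ ∈ S, c χ * eval χ q) ∧
      (∀ χ, (l χ).totalDegree ≤ n) ∧
      (∀ χ ∈ S, eval χ (l χ) = 1) ∧ ∀ χ ∈ S, ∀ χ' ∈ S, χ' ≠ χ → eval χ' (l χ) = 0 := by
  classical
  obtain ⟨T, hsym, hcomm, hT⟩ := exists_commuting_symmetric_multiplication e L hinner hsurj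
  obtain ⟨v, hv, horth, hsum⟩ :=
    LinearMap.IsSymmetric.exists_sum_joint_eigenvectors T hsym hcomm (e 1)
  have hep := map_eq_sum_eval_smul e T hT v hv hsum.symm
  have hli : LinearIndependent ℝ (fun χ : v.support => v χ) := by
    refine linearIndependent_of_ne_zero_of_inner_eq_zero
      (fun χ => Finsupp.mem_support_iff.mp χ.2) fun χ χ' hne => horth _ _ fun h => hne ?_
    exact Subtype.ext h
  have hspan : Submodule.span ℝ (Set.range fun χ : v.support => v χ) = ⊤ := by
    rw [Submodule.eq_top_iff']
    intro x
    obtain ⟨p, hp, rfl⟩ := hsurj x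
    rw [hep p (by omega)]
    exact Submodule.sum_mem _ fun χ hχ =>
      Submodule.smul_mem _ _ (Submodule.subset_span ⟨⟨χ, hχ⟩, rfl⟩)
  choose l hl hel using hsurj
  have hself : ∀ χ ∈ v.support, inner ℝ (v χ) (v χ) ≠ 0 := fun χ hχ =>
    (real_inner_self_pos.mpr (Finsupp.mem_support_iff.mp hχ)).ne'
  -- By orthogonality, pairing with `v χ'` isolates the value at `χ'`; hence any preimage of `v χ`
  -- interpolates at the nodes.
  have hval : ∀ χ, ∀ χ' ∈ v.support,
      eval χ' (l (v χ)) * inner ℝ (v χ') (v χ') = inner ℝ (v χ) (v χ') := by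
    intro χ χ' hχ'
    conv_rhs => rw [← hel (v χ), hep _ ((hl _).trans (Nat.le_succ n)), sum_inner]
    rw [Finset.sum_eq_single_of_mem χ' hχ' (fun χ'' _ hne => by
      rw [real_inner_smul_left, horth _ _ hne, mul_zero]), real_inner_smul_left]
  refine ⟨v.support, fun χ => inner ℝ (v χ) (v χ), fun χ => l (v χ), ?_, ?_, ?_, fun _ => hl _, ?_, ?_⟩
  · rw [← finrank_top ℝ E, ← hspan, finrank_span_eq_card hli, Fintype.card_coe]
  · intro χ hχ
    exact real_inner_self_pos.mpr (Finsupp.mem_support_iff.mp hχ)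
  · intro q hq
    let Q : MvPolynomial σ ℝ →ₗ[ℝ] ℝ :=
      ∑ χ ∈ v.support, inner ℝ (v χ) (v χ) • (aeval χ : MvPolynomial σ ℝ →ₐ[ℝ] ℝ).toLinearMap
    have hQ : ∀ q, Q q = ∑ χ ∈ v.support, inner ℝ (v χ) (v χ) * eval χ q := by
      intro q
      simp [Q, LinearMap.sum_apply, aeval_eq_eval]
    rw [← hQ]
    refine linearMap_eq_of_monomial (m := 2 * (n + 1)) (fun i hi => ?_) hq
    -- Splitting a monomial into two factors of degree at most `n + 1` turns its functional value
    -- into an inner product.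
    obtain ⟨j, k, rfl, hj, hk⟩ : ∃ j k : σ →₀ ℕ, i = j + k ∧ j.degree ≤ n + 1 ∧
        k.degree ≤ n + 1 := by
      rcases le_total i.degree (n + 1) with h | h
      · exact ⟨i, 0, by simp, h, by simp⟩
      · obtain ⟨j, hji, hj⟩ := Finsupp.exists_le_degree_eq i (n + 1) h
        obtain ⟨k, rfl⟩ := exists_add_of_le hji
        refine ⟨j, k, rfl, hj.le, ?_⟩
        rw [map_add] at hi
        omega
    have hjd := (totalDegree_monomial_le j (1 : ℝ)).trans hj
    have hkd := (totalDegree_monomial_le k (1 : ℝ)).trans hk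
    have hmul : (monomial (j + k) 1 : MvPolynomial σ ℝ) = monomial j 1 * monomial k 1 := by
      rw [monomial_mul, one_mul]
    rw [hmul, ← hinner _ _ hjd hkd, hQ, hep _ hjd, hep _ hkd, sum_inner]
    refine Finset.sum_congr rfl fun χ hχ => ?_
    rw [inner_sum, Finset.sum_eq_single_of_mem χ hχ, real_inner_smul_left, real_inner_smul_right,
      map_mul]
    · ring
    · intro χ' _ hne
      rw [real_inner_smul_left, real_inner_smul_right, horth _ _ hne.symm, mul_zero, mul_zero]
  · intro χ hχ
    exact mul_right_cancel₀ (hself χ hχ) ((hval χ χ hχ).trans (one_mul _).symm)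
  · intro χ _ χ' hχ' hne
    have h := hval χ χ' hχ'
    rw [horth _ _ hne.symm] at h
    exact (mul_eq_zero.mp h).resolve_right (hself χ' hχ')

end MvPolynomial

/-! ### Atomic measures and uniqueness. -/

namespace MeasureTheory.Measure

variable {X : Type*} [MeasurableSpace X] [MeasurableSingletonClass X]

theorem restrict_finset_eq_sum_dirac (ν : Measure X) (S : Finset X) :
    ν.restrict S = ∑ p ∈ S, ν {p} • dirac p := by
  classical
  induction S using Finset.induction_on with
  | empty => simp
  | insert a S ha ih =>
    rw [Finset.sum_insert ha, ← ih, Finset.coe_insert, Set.insert_eq,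
      restrict_union (by simpa using ha) S.measurableSet, restrict_singleton]

theorem support_sum_smul_dirac [TopologicalSpace X] [T1Space X] (S : Finset X) (c : X → ENNReal)
    (hc : ∀ p ∈ S, c p ≠ 0) : (∑ p ∈ S, c p • dirac p).support = (S : Set X) := by
  refine Set.Subset.antisymm ?_ fun x hx => ?_
  · refine support_subset_of_isClosed S.finite_toSet.isClosed ?_
    rw [mem_ae_iff, finsetSum_apply]
    refine Finset.sum_eq_zero fun p hp => ?_
    simp [dirac_apply, hp]
  · rw [mem_support_iff_forall]
    intro U hU
    rw [finsetSum_apply, pos_iff_ne_zero]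
    intro h
    have h1 := Finset.sum_eq_zero_iff.mp h x hx
    rw [smul_apply, dirac_apply_of_mem (mem_of_mem_nhds hU)] at h1
    exact hc x hx (by simpa using h1)

end MeasureTheory.Measure

namespace MvPolynomial

variable {σ : Type*} [Fintype σ]

/-- A measure whose moments up to degree `2 n + 2` are given by a finite quadrature rule with
interpolating polynomials of degree at most `n` is the atomic measure of that rule. -/
theorem eq_sum_dirac_of_quadrature {n : ℕ} {L : MvPolynomial σ ℝ → ℝ} {S : Finset (σ → ℝ)}
    {c : (σ → ℝ) → ℝ} {l : (σ → ℝ) → MvPolynomial σ ℝ}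
    (hL : ∀ q : MvPolynomial σ ℝ, q.totalDegree ≤ 2 * (n + 1) → L q = ∑ χ ∈ S, c χ * eval χ q)
    (hl : ∀ χ, (l χ).totalDegree ≤ n) (hone : ∀ χ ∈ S, eval χ (l χ) = 1)
    (hzero : ∀ χ ∈ S, ∀ χ' ∈ S, χ' ≠ χ → eval χ' (l χ) = 0) (ν : Measure (σ → ℝ))
    (hν : ∀ q : MvPolynomial σ ℝ, q.totalDegree ≤ 2 * (n + 1) →
      Integrable (fun x => eval x q) ν ∧ ∫ x, eval x q ∂ν = L q) :
    ν = ∑ χ ∈ S, ENNReal.ofReal (c χ) • Measure.dirac χ := by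
  classical
  have hfin : IsFiniteMeasure ν := by
    have h := (hν 1 (by simp)).1
    simp only [map_one] at h
    exact (integrable_const_iff_isFiniteMeasure one_ne_zero).mp h
  -- The integral of `p * p` is a weighted sum of zeros, and the integrand is nonnegative.
  have hvanish : ∀ p : MvPolynomial σ ℝ, p.totalDegree ≤ n + 1 → (∀ χ ∈ S, eval χ p = 0) →
      ∀ᵐ x ∂ν, eval x p = 0 := by
    intro p hp h0
    have hdeg : (p * p).totalDegree ≤ 2 * (n + 1) := by
      have := totalDegree_mul p p
      omega
    obtain ⟨hint, heq⟩ := hν _ hdeg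
    rw [hL _ hdeg, Finset.sum_eq_zero (fun χ hχ => by rw [map_mul, h0 χ hχ]; ring)] at heq
    have hae := (integral_eq_zero_iff_of_nonneg
      (fun x => by rw [map_mul]; exact mul_self_nonneg _) hint).mp heq
    filter_upwards [hae] with x hx
    simpa using hx
  -- The factor of degree one uses up the allowance `n + 1`; it forces `x = χ` wherever `l χ` is
  -- nonzero.
  have hnode : ∀ χ ∈ S, ∀ k, ∀ᵐ x ∂ν, eval x ((X k - C (χ k)) * l χ) = 0 := by
    intro χ hχ k
    refine hvanish _ ?_ fun χ' hχ' => ?_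
    · have h1 := totalDegree_mul (X k - C (χ k)) (l χ)
      have h2 := totalDegree_sub_C_le (X k : MvPolynomial σ ℝ) (χ k)
      rw [totalDegree_X] at h2
      have h3 := hl χ
      omega
    · by_cases h : χ' = χ
      · subst h
        simp
      · rw [map_mul, hzero χ hχ χ' hχ' h, mul_zero]
  -- Off the nodes every `l χ` vanishes almost everywhere, which contradicts their sum being 1.
  have hsum : ∀ᵐ x ∂ν, eval x (1 - ∑ χ ∈ S, l χ) = 0 := by
    refine hvanish _ ?_ fun χ' hχ' => ?_
    · have h1 : (∑ χ ∈ S, l χ).totalDegree ≤ n :=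
        totalDegree_finsetSum_le fun χ _ => hl χ
      have h2 := totalDegree_sub (1 : MvPolynomial σ ℝ) (∑ χ ∈ S, l χ)
      rw [totalDegree_one] at h2
      omega
    · rw [map_sub, map_one, map_sum, Finset.sum_eq_single_of_mem χ' hχ'
        (fun χ hχ hne => hzero χ hχ χ' hχ' hne.symm), hone χ' hχ', sub_self]
  have hmem : ∀ᵐ x ∂ν, x ∈ (S : Set (σ → ℝ)) := by
    have hall : ∀ᵐ x ∂ν, ∀ χ ∈ S, ∀ k, eval x ((X k - C (χ k)) * l χ) = 0 := by
      rw [Filter.eventually_all_finset]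
      exact fun χ hχ => ae_all_iff.mpr (hnode χ hχ)
    filter_upwards [hall, hsum] with x hx h1
    by_contra hxS
    have hlx : ∀ χ ∈ S, eval x (l χ) = 0 := by
      intro χ hχ
      by_contra hne
      refine hxS ?_
      have : x = χ := by
        funext k
        have := (mul_eq_zero.mp ((map_mul _ _ _).symm.trans (hx χ hχ k))).resolve_right hne
        simpa [sub_eq_zero] using this
      exact this ▸ hχ
    rw [map_sub, map_one, map_sum, Finset.sum_eq_zero hlx] at h1
    norm_num at h1
  have hmass : ∀ χ ∈ S, ν {χ} = ENNReal.ofReal (c χ) := by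
    intro χ hχ
    have hd : (l χ).totalDegree ≤ 2 * (n + 1) := (hl χ).trans (by omega)
    have h1 := (hν _ hd).2
    rw [hL _ hd, Finset.sum_eq_single_of_mem χ hχ
      (fun χ' hχ' hne => by rw [hzero χ hχ χ' hχ' hne, mul_zero]), hone χ hχ, mul_one] at h1
    -- On the nodes `l χ` is the indicator of `χ`, so its integral is the mass there.
    have h2 : (fun x => eval x (l χ)) =ᵐ[ν] Set.indicator {χ} 1 := by
      filter_upwards [hmem] with x hx
      by_cases h : x = χ
      · subst h
        simp [hone x hχ]
      · rw [hzero χ hχ x hx h, Set.indicator_of_notMem (by simpa using h)]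
    rw [integral_congr_ae h2, integral_indicator_one (measurableSet_singleton χ)] at h1
    rw [← h1, ofReal_measureReal]
  rw [← Measure.restrict_eq_self_of_ae_mem hmem, Measure.restrict_finset_eq_sum_dirac]
  exact Finset.sum_congr rfl fun χ hχ => by rw [hmass χ hχ]

theorem integral_sum_smul_dirac (S : Finset (σ → ℝ)) (c : (σ → ℝ) → ℝ) (hc : ∀ χ ∈ S, 0 < c χ)
    (f : (σ → ℝ) → ℝ) :
    Integrable f (∑ χ ∈ S, ENNReal.ofReal (c χ) • Measure.dirac χ) ∧
      ∫ x, f x ∂(∑ χ ∈ S, ENNReal.ofReal (c χ) • Measure.dirac χ) = ∑ χ ∈ S, c χ * f χ := by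
  have hi : ∀ χ ∈ S, Integrable f (ENNReal.ofReal (c χ) • Measure.dirac χ) := fun χ _ =>
    (integrable_dirac (by finiteness)).smul_measure ENNReal.ofReal_ne_top
  refine ⟨integrable_finsetSum_measure.mpr hi, ?_⟩
  rw [integral_finsetSum_measure hi]
  refine Finset.sum_congr rfl fun χ hχ => ?_
  rw [integral_smul_measure, integral_dirac, ENNReal.toReal_ofReal (hc χ hχ).le, smul_eq_mul]

end MvPolynomial

/-! ### From the moment sequence to the measure. -/

theorem MvPolynomial.inner_map_eq_of_monomial {σ E : Type*} [NormedAddCommGroup E]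
    [InnerProductSpace ℝ E] {m : ℕ} (e : MvPolynomial σ ℝ →ₗ[ℝ] E)
    (L : MvPolynomial σ ℝ →ₗ[ℝ] ℝ)
    (h : ∀ i j : σ →₀ ℕ, i.degree ≤ m → j.degree ≤ m →
      inner ℝ (e (monomial i 1)) (e (monomial j 1)) = L (monomial (i + j) 1))
    {p q : MvPolynomial σ ℝ} (hp : p.totalDegree ≤ m) (hq : q.totalDegree ≤ m) :
    inner ℝ (e p) (e q) = L (p * q) := by
  refine linearMap_eq_of_monomial (f := (innerₗ E).flip (e q) ∘ₗ e)
    (g := L ∘ₗ LinearMap.mulRight ℝ q) (fun i hi => ?_) hp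
  refine linearMap_eq_of_monomial (f := innerₗ E (e (monomial i 1)) ∘ₗ e)
    (g := L ∘ₗ LinearMap.mulLeft ℝ (monomial i 1)) (fun j hj => ?_) hq
  change inner ℝ (e (monomial i 1)) (e (monomial j 1)) = L (monomial i 1 * monomial j 1)
  rw [h i j hi hj, monomial_mul, one_mul]

/-- The Riesz functional of a truncated multisequence, extended by zero to monomials of degree
exceeding `m`. -/
noncomputable def TruncSeq.riesz {d m : ℕ} (γ : TruncSeq d m) :
    MvPolynomial (Fin d) ℝ →ₗ[ℝ] ℝ :=
  (MvPolynomial.basisMonomials (Fin d) ℝ).constr ℝ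
    fun i => if h : i.degree ≤ m then γ ⟨i, h⟩ else 0

open MvPolynomial in
theorem TruncSeq.riesz_monomial {d m : ℕ} (γ : TruncSeq d m) (i : MultiIndex d m) :
    γ.riesz (monomial i.1 1) = γ i := by
  have h := (basisMonomials (Fin d) ℝ).constr_basis ℝ
    (fun i => if h : i.degree ≤ m then γ ⟨i, h⟩ else 0) i.1
  rw [coe_basisMonomials] at h
  rw [TruncSeq.riesz, h, dif_pos i.2]

open MvPolynomial in
theorem IsRepresentingMeasure.integral_eval {d m : ℕ} {γ : TruncSeq d m}
    {ν : Measure (Fin d → ℝ)} (hν : IsRepresentingMeasure γ ν) (q : MvPolynomial (Fin d) ℝ)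
    (hq : q.totalDegree ≤ m) :
    Integrable (fun x => eval x q) ν ∧ ∫ x, eval x q ∂ν = γ.riesz q := by
  have hterm : ∀ i ∈ q.support, Integrable (fun x => coeff i q * ∏ k, x k ^ i k) ν ∧
      ∫ x, coeff i q * ∏ k, x k ^ i k ∂ν = γ.riesz (monomial i (coeff i q)) := by
    intro i hi
    have hd : i.degree ≤ m := (le_totalDegree hi).trans hq
    obtain ⟨h1, h2⟩ := hν ⟨i, hd⟩
    refine ⟨h1.const_mul _, ?_⟩
    rw [integral_const_mul, h2, ← γ.riesz_monomial, ← smul_eq_mul, ← map_smul, smul_monomial,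
      smul_eq_mul, mul_one]
  have heval : (fun x => eval x q) = fun x => ∑ i ∈ q.support, coeff i q * ∏ k, x k ^ i k :=
    funext fun x => eval_eq' x q
  rw [heval, integral_finsetSum _ fun i hi => (hterm i hi).1]
  refine ⟨integrable_finsetSum _ fun i hi => (hterm i hi).1, ?_⟩
  conv_rhs => rw [q.as_sum, map_sum]
  exact Finset.sum_congr rfl fun i hi => (hterm i hi).2

open MvPolynomial in
theorem IsFlatExtension.exists_quadrature {d n : ℕ} {β : TruncSeq d (2 * n)}
    (hpos : (momentMatrix β).PosSemidef) {γ : TruncSeq d (2 * (n + 1))}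
    (hflat : IsFlatExtension β γ) :
    ∃ (S : Finset (Fin d → ℝ)) (c : (Fin d → ℝ) → ℝ) (l : (Fin d → ℝ) → MvPolynomial (Fin d) ℝ),
      S.card = (momentMatrix β).rank ∧ (∀ χ ∈ S, 0 < c χ) ∧
      (∀ q : MvPolynomial (Fin d) ℝ, q.totalDegree ≤ 2 * (n + 1) →
        γ.riesz q = ∑ χ ∈ S, c χ * eval χ q) ∧
      (∀ χ, (l χ).totalDegree ≤ n) ∧
      (∀ χ ∈ S, eval χ (l χ) = 1) ∧ ∀ χ ∈ S, ∀ χ' ∈ S, χ' ≠ χ → eval χ' (l χ) = 0 := by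
  let f : MultiIndex d n → MultiIndex d (n + 1) := fun i => ⟨i.1, i.2.trans n.le_succ⟩
  have hsub : (momentMatrix γ).submatrix f f = momentMatrix β := by
    ext i j
    exact hflat.1 (i.add j)
  have hherm : (momentMatrix γ).IsHermitian := by
    ext i j
    exact congrArg γ (Subtype.ext (add_comm j.1 i.1))
  have hrank := hflat.2
  rw [← hsub] at hpos hrank
  obtain ⟨b, hb⟩ := (Matrix.posSemidef_of_submatrix_of_rank_eq _ hherm f hpos hrank).exists_gram
  have hbsub : Matrix.gram ℝ (b ∘ f) = (momentMatrix γ).submatrix f f := by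
    rw [← hb]
    rfl
  let E := Submodule.span ℝ (Set.range b)
  -- Flatness enters here: the Gram vectors of degree at most `n` span the same space as all of
  -- them.
  have hE : Submodule.span ℝ (Set.range (b ∘ f)) = E := by
    refine Submodule.eq_of_le_of_finrank_eq (Submodule.span_mono (Set.range_comp_subset_range f b)) ?_
    rw [← Matrix.rank_gram_euclidean, ← Matrix.rank_gram_euclidean, hb, hbsub, hrank]
  let b' : MultiIndex d (n + 1) → E := fun i => ⟨b i, Submodule.subset_span ⟨i, rfl⟩⟩
  let e : MvPolynomial (Fin d) ℝ →ₗ[ℝ] E := (basisMonomials (Fin d) ℝ).constr ℝ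
    fun i => if h : i.degree ≤ n + 1 then b' ⟨i, h⟩ else 0
  have he : ∀ i : MultiIndex d (n + 1), e (monomial i.1 1) = b' i := by
    intro i
    have h := (basisMonomials (Fin d) ℝ).constr_basis ℝ
      (fun i => if h : i.degree ≤ n + 1 then b' ⟨i, h⟩ else 0) i.1
    rw [coe_basisMonomials] at h
    rw [h, dif_pos i.2]
  have hinner : ∀ p q : MvPolynomial (Fin d) ℝ, p.totalDegree ≤ n + 1 → q.totalDegree ≤ n + 1 →
      inner ℝ (e p) (e q) = γ.riesz (p * q) := by
    refine fun p q => inner_map_eq_of_monomial e γ.riesz fun i j hi hj => ?_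
    have h1 := congrFun (congrFun hb ⟨i, hi⟩) ⟨j, hj⟩
    have h2 := γ.riesz_monomial (MultiIndex.add ⟨i, hi⟩ ⟨j, hj⟩)
    rw [he ⟨i, hi⟩, he ⟨j, hj⟩]
    exact h1.trans h2.symm
  have hsurj : ∀ x : E, ∃ p : MvPolynomial (Fin d) ℝ, p.totalDegree ≤ n ∧ e p = x := by
    intro x
    have hx : (x : EuclideanSpace ℝ (MultiIndex d (n + 1))) ∈
        Submodule.span ℝ (Set.range (b ∘ f)) := hE.ge x.2
    obtain ⟨w, hw⟩ := (Submodule.mem_span_range_iff_exists_fun ℝ).mp hx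
    refine ⟨∑ j, w j • monomial j.1 1, ?_, ?_⟩
    · exact totalDegree_finsetSum_le fun j _ =>
        (totalDegree_smul_le _ _).trans ((totalDegree_monomial_le _ _).trans j.2)
    · rw [map_sum]
      refine Subtype.ext ?_
      rw [← hw, Submodule.coe_sum]
      refine Finset.sum_congr rfl fun j _ => ?_
      rw [map_smul, he (f j)]
      rfl
  have hfr : Module.finrank ℝ E = (momentMatrix β).rank := by
    rw [← hflat.2, ← hb, Matrix.rank_gram_euclidean]
  rw [← hfr]
  exact MvPolynomial.exists_quadrature e γ.riesz hinner hsurj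

theorem corollaryc1 (d n : ℕ) (β : TruncSeq d (2 * n))
    (hpos : (momentMatrix β).PosSemidef)
    (γ : TruncSeq d (2 * (n + 1))) (hflat : IsFlatExtension β γ) :
    ∃ μ : Measure (Fin d → ℝ),
      IsRepresentingMeasure γ μ ∧
      (∀ ν : Measure (Fin d → ℝ), IsRepresentingMeasure γ ν → ν = μ) ∧
      μ.support.encard = ((momentMatrix β).rank : ℕ∞) ∧
      IsAtomicMeasure (momentMatrix β).rank μ := by
  obtain ⟨S, c, l, hcard, hc, hL, hl, hone, hzero⟩ := hflat.exists_quadrature hpos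
  refine ⟨∑ χ ∈ S, ENNReal.ofReal (c χ) • Measure.dirac χ, fun i => ?_, fun ν hν => ?_, ?_,
    S, c, hcard, hc, rfl⟩
  · obtain ⟨h1, h2⟩ := MvPolynomial.integral_sum_smul_dirac S c hc
      (fun x : Fin d → ℝ => ∏ k, x k ^ i.1 k)
    refine ⟨h1, h2.trans ?_⟩
    rw [← γ.riesz_monomial i, hL _ ((MvPolynomial.totalDegree_monomial_le _ _).trans i.2)]
    refine Finset.sum_congr rfl fun χ _ => ?_
    rw [MvPolynomial.eval_monomial, one_mul, Finsupp.prod_pow]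
  · exact MvPolynomial.eq_sum_dirac_of_quadrature hL hl hone hzero ν hν.integral_eval
  · rw [Measure.support_sum_smul_dirac S _ fun χ hχ =>
      (ENNReal.ofReal_pos.mpr (hc χ hχ)).ne', Set.encard_coe_eq_coe_finsetCard, hcard]
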